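/- **Model.** Consider a call centre with four levels. For $i\in\{1,2,3,4\}$ there are $k_i\in\mathbb N$ level $i$ agents; level $i$ callers arrive at rate $\lambda_i$, a waiting level $i$ caller abandons at rate $\theta_i$ at cost $\gamma_i$, and a level $i$ agent serves a level $i$ caller at rate $\mu_i$; for $i\le 3$ a level $i+1$ agent serves a level $i$ caller at rate $\mu_i'$. All rates are non-negative reals, the costs are real. The capacity is $\ell\in\mathbb N$, and an arrival that finds the system full is blocked at cost $\beta$. Fix a reservation vector $\mathbf n=(n_2,n_3,n_4)$ with $n_i\in\{0,\dots,k_i\}$. A state is $z=(a,a_1,b,b_1,c,c_1,d)\in\mathbb Z^7$: $a,b,c,d$ are the numbers of level 1, 2, 3, 4 callers in the system, and $a_1,b_1,c_1$ the numbers of level 1, 2, 3 callers being served by level 2, 3, 4 agents. Let $\Omega$ be the set of states with $a,b,c,d\in\{0,\dots,\ell\}$, $a+b+c+d\le\ell$, $$\min(a-k_1,k_2-b-n_2)\mathbb 1_{a>k_1,\,b<k_2-n_2}\le a_1\le\min(k_2-n_2,a),$$ $$\min(b-k_2,k_3-c-n_3)\mathbb 1_{b>k_2,\,c<k_3-n_3}\le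 b_1\le\min(k_3-n_3,b),$$ $$\min(c-k_3,k_4-d-n_4)\mathbb 1_{c>k_3,\,d<k_4-n_4}\le c_1\le\min(k_4-n_4,c).$$ Put $$\begin{aligned} \iota_1&=\mathbb 1(a-a_1\ge k_1,\ b-b_1<k_2-n_2-a_1), & \kappa_1&=\mathbb 1(a-a_1>k_1,\ b-b_1=k_2-n_2-a_1),\\ \iota_2&=\mathbb 1(b-b_1\ge k_2,\ c-c_1<k_3-n_3-b_1), & \kappa_2&=\mathbb 1(b-b_1>k_2-a_1,\ c=k_3-n_3-b_1),\\ \iota_3&=\mathbb 1(c-c_1\ge k_3,\ d<k_4-n_4-c_1), & \kappa_2'&=\mathbb 1(b-b_1>k_2,\ c-c_1=k_3-n_3-b_1),\\ && \kappa_3&=\mathbb 1(c-c_1>k_3-b_1,\ d=k_4-n_4-c_1). \end{aligned}$$ In a state $z\in\Omega$ the following events occur, independently and at the stated rates. * Arrivals at rates $\lambda_1,\lambda_2,\lambda_3,\lambda_4$. If $a+b+c+d<\ell$ they lead to $(a+1,a_1+\iota_1,b,b_1,c,c_1,d)$, $(a,a_1,b+1,b_1+\iota_2,c,c_1,d)$,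 $(a,a_1,b,b_1,c+1,c_1+\iota_3,d)$ and $(a,a_1,b,b_1,c,c_1,d+1)$ respectively. If $a+b+c+d=\ell$ the state does not change and the cost is $\beta$. * Services: to $(a-1,a_1,b,b_1,c,c_1,d)$ at rate $\min(k_1,a-a_1)\mu_1$; to $(a-1,a_1-(1-\kappa_1),b,b_1,c,c_1,d)$ at rate $a_1\mu_1'$; to $(a,a_1+\kappa_1,b-1,b_1,c,c_1,d)$ at rate $\min(b-b_1,k_2-a_1)\mu_2$; to $(a,a_1,b-1,b_1-(1-\kappa_2),c,c_1,d)$ at rate $b_1\mu_2'$; to $(a,a_1,b,b_1+\kappa_2',c-1,c_1,d)$ at rate $\min(c-c_1,k_3-b_1)\mu_3$; to $(a,a_1,b,b_1,c-1,c_1-(1-\kappa_3),d)$ at rate $c_1\mu_3'$; to $(a,a_1,b,b_1,c,c_1+\kappa_3,d-1)$ at rate $\min(d,k_4-c_1)\mu_4$. * Abandonments: to $(a-1,a_1,b,b_1,c,c_1,d)$ at rate $w_1\theta_1$ and cost $\gamma_1$; to $(a,a_1,b-1,b_1,c,c_1,d)$ at rate $w_2\theta_2$ and cost $\gamma_2$;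 to $(a,a_1,b,b_1,c-1,c_1,d)$ at rate $w_3\theta_3$ and cost $\gamma_3$; to $(a,a_1,b,b_1,c,c_1,d-1)$ at rate $w_4\theta_4$ and cost $\gamma_4$. Here $w_1=\max(0,a-(k_1+a_1))$, $w_2=\max(0,b-(k_2-a_1+b_1))$, $w_3=\max(0,c-(k_3-b_1+c_1))$, $w_4=\max(0,d-(k_4-c_1))$. The system is followed as long as its state is in $\Omega$: nothing happens, and no cost arises, in a state outside $\Omega$. Let $A_z(\mathbf n,t)$ be the expected cost of abandonments and losses of this continuous-time Markov chain during $(0,t)$, given that it is in state $z$ at time $0$, and for $s\in\mathbb C$ with $\operatorname{Re}s>0$ let $\tilde A_z(\mathbf n,s)=\int_0^\infty e^{-st}A_z(\mathbf n,t)\,dt$. **Theorem.** For every $z$ and $t$ the sum of the costs in $(0,t)$ converges absolutely almost surely and is integrable, and for $\operatorname{Re}s>0$ the function $e^{-st}A_z(\mathbf n,t)$ of $t$ is integrable on $(0,\infty)$. For $\operatorname{Re}s>0$ and $z=(a,a_1,b,b_1,c,c_1,d)\in\Omega$, $$\tilde A_{a,a_1,b,b_1,c,c_1,d}(\mathbf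 n,s)=\frac{\xi_{a,a_1,b,b_1,c,c_1,d}(\mathbf n,s)}{\psi_{a,a_1,b,b_1,c,c_1,d}(s)},\qquad \psi_{a,a_1,b,b_1,c,c_1,d}(s)\ne0,$$ where (omitting the arguments $\mathbf n,s$ of $\tilde A$) $$\begin{aligned} \xi={}&\bigl(\lambda_1\tilde A_{a+1,a_1+\iota_1,b,b_1,c,c_1,d}+\lambda_2\tilde A_{a,a_1,b+1,b_1+\iota_2,c,c_1,d}+\lambda_3\tilde A_{a,a_1,b,b_1,c+1,c_1+\iota_3,d}+\lambda_4\tilde A_{a,a_1,b,b_1,c,c_1,d+1}\bigr)\mathbb 1_{a+b+c+d<\ell}\\ &+\min(k_1,a-a_1)\mu_1\tilde A_{a-1,a_1,b,b_1,c,c_1,d}+a_1\mu_1'\tilde A_{a-1,a_1-(1-\kappa_1),b,b_1,c,c_1,d}\\ &+\min(b-b_1,k_2-a_1)\mu_2\tilde A_{a,a_1+\kappa_1,b-1,b_1,c,c_1,d}+b_1\mu_2'\tilde A_{a,a_1,b-1,b_1-(1-\kappa_2),c,c_1,d}\\ &+\min(c-c_1,k_3-b_1)\mu_3\tilde A_{a,a_1,b,b_1+\kappa_2',c-1,c_1,d}+c_1\mu_3'\tilde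 A_{a,a_1,b,b_1,c-1,c_1-(1-\kappa_3),d}\\ &+\min(d,k_4-c_1)\mu_4\tilde A_{a,a_1,b,b_1,c,c_1+\kappa_3,d-1}\\ &+w_1\theta_1\bigl(\tilde A_{a-1,a_1,b,b_1,c,c_1,d}+\gamma_1/s\bigr)+w_2\theta_2\bigl(\tilde A_{a,a_1,b-1,b_1,c,c_1,d}+\gamma_2/s\bigr)\\ &+w_3\theta_3\bigl(\tilde A_{a,a_1,b,b_1,c-1,c_1,d}+\gamma_3/s\bigr)+w_4\theta_4\bigl(\tilde A_{a,a_1,b,b_1,c,c_1,d-1}+\gamma_4/s\bigr)\\ &+(\lambda_1+\lambda_2+\lambda_3+\lambda_4)\,\beta\,\mathbb 1_{a+b+c+d=\ell}/s,\\ \psi={}&(\lambda_1+\lambda_2+\lambda_3+\lambda_4)\mathbb 1_{a+b+c+d<\ell}+\min(k_1,a-a_1)\mu_1+a_1\mu_1'+\min(b-b_1,k_2-a_1)\mu_2+b_1\mu_2'\\ &+\min(c-c_1,k_3-b_1)\mu_3+c_1\mu_3'+\min(d,k_4-c_1)\mu_4+w_1\theta_1+w_2\theta_2+w_3\theta_3+w_4\theta_4+s.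 \end{aligned}$$ Moreover $\tilde A_{a,a_1,b,b_1,c,c_1,d}(\mathbf n,s)=0$ for every $(a,a_1,b,b_1,c,c_1,d)\in\mathbb Z^7\setminus\Omega$. -/

import Mathlib

open MeasureTheory ProbabilityTheory
open scoped ENNReal NNReal

noncomputable section

namespace FourLevel

/-- Parameters of the four-level call centre.  For `i = 1, 2, 3, 4`: `kᵢ` level `i` agents; arrival
rate `lamᵢ`, abandonment rate `thetaᵢ` and abandonment cost `gammaᵢ` of level `i` callers; service
rate `muᵢ` of a level `i` caller served by a level `i` agent; service rate `muUpᵢ` (for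
`i = 1, 2, 3`) of a level `i` caller served by a level `i + 1` agent.  `cap` is the total capacity
of the system and `beta` the blocking cost. -/
structure CallCentre where
  (k1 k2 k3 k4 : ℕ)
  (cap : ℕ)
  (lam1 lam2 lam3 lam4 : ℝ≥0)
  (mu1 mu2 mu3 mu4 : ℝ≥0)
  (muUp1 muUp2 muUp3 : ℝ≥0)
  (theta1 theta2 theta3 theta4 : ℝ≥0)
  (gamma1 gamma2 gamma3 gamma4 : ℝ)
  (beta : ℝ)

/-- A reservation vector `(n₂, n₃, n₄)`. -/
structure Reservation where
  (n2 n3 n4 : ℕ)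

/-- At most as many agents are reserved at a level as there are at that level. -/
def Reservation.Admissible (n : Reservation) (M : CallCentre) : Prop :=
  n.n2 ≤ M.k2 ∧ n.n3 ≤ M.k3 ∧ n.n4 ≤ M.k4

/-- A 7-tuple `(a, a₁, b, b₁, c, c₁, d)`: there are `a, b, c, d` callers of levels 1, 2, 3, 4, of
which `a₁, b₁, c₁` callers of levels 1, 2, 3 are being served by agents of levels 2, 3, 4. -/
@[ext]
structure State where
  (a a1 b b1 c c1 d : ℤ)

instance : Countable State := by
  have h : Function.Injective
      (fun z : State => (z.a, z.a1, z.b, z.b1, z.c, z.c1, z.d)) := by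
    intro x y h
    simp only [Prod.mk.injEq] at h
    obtain ⟨h1, h2, h3, h4, h5, h6, h7⟩ := h
    exact State.ext h1 h2 h3 h4 h5 h6 h7
  exact h.countable

instance : MeasurableSpace State := ⊤

instance : DiscreteMeasurableSpace State := ⟨fun _ => trivial⟩

/-- The indicator of a proposition, as an integer. -/
def ind (p : Prop) [Decidable p] : ℤ := if p then 1 else 0

/-- The total number of callers in the system. -/
def State.total (z : State) : ℤ := z.a + z.b + z.c + z.d

/-- The state space `Ω`. -/
def stateSpace (M : CallCentre) (n : Reservation) : Set State :=
  {z |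
    (0 ≤ z.a ∧ z.a ≤ M.cap) ∧ (0 ≤ z.b ∧ z.b ≤ M.cap) ∧
    (0 ≤ z.c ∧ z.c ≤ M.cap) ∧ (0 ≤ z.d ∧ z.d ≤ M.cap) ∧
    z.total ≤ M.cap ∧
    (min (z.a - M.k1) (M.k2 - z.b - n.n2) * ind (z.a > M.k1 ∧ z.b < M.k2 - n.n2) ≤ z.a1 ∧
      z.a1 ≤ min (M.k2 - n.n2 : ℤ) z.a) ∧
    (min (z.b - M.k2) (M.k3 - z.c - n.n3) * ind (z.b > M.k2 ∧ z.c < M.k3 - n.n3) ≤ z.b1 ∧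
      z.b1 ≤ min (M.k3 - n.n3 : ℤ) z.b) ∧
    (min (z.c - M.k3) (M.k4 - z.d - n.n4) * ind (z.c > M.k3 ∧ z.d < M.k4 - n.n4) ≤ z.c1 ∧
      z.c1 ≤ min (M.k4 - n.n4 : ℤ) z.c)}

/-- The events that can happen: a level `i` caller arrives (and is blocked if the system is full),
a level `i` caller is served by a level `i` agent, a level `i` caller is served by a level `i + 1`
agent, a waiting level `i` caller abandons. -/
inductive Event where
  | arrive1 | arrive2 | arrive3 | arrive4
  | serve1 | serve2 | serve3 | serve4
  | serveUp1 | serveUp2 | serveUp3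
  | abandon1 | abandon2 | abandon3 | abandon4
  deriving DecidableEq

instance : Fintype Event where
  elems := {.arrive1, .arrive2, .arrive3, .arrive4, .serve1, .serve2, .serve3, .serve4,
    .serveUp1, .serveUp2, .serveUp3, .abandon1, .abandon2, .abandon3, .abandon4}
  complete e := by cases e <;> decide

instance : Nonempty Event := ⟨.arrive1⟩

instance : MeasurableSpace Event := ⊤

instance : DiscreteMeasurableSpace Event := ⟨fun _ => trivial⟩

open Classical in
/-- The rate at which an event happens in the state `z`.  The system is followed only inside `Ω`:
outside `Ω` nothing happens.  (The integers below are nonnegative on `Ω`, so `Int.toNat` does not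
change them.) -/
def rate (M : CallCentre) (n : Reservation) (z : State) (e : Event) : ℝ≥0 :=
  if z ∈ stateSpace M n then
    match e with
    | .arrive1 => M.lam1
    | .arrive2 => M.lam2
    | .arrive3 => M.lam3
    | .arrive4 => M.lam4
    | .serve1 => (min (M.k1 : ℤ) (z.a - z.a1)).toNat * M.mu1
    | .serve2 => (min (z.b - z.b1) (M.k2 - z.a1)).toNat * M.mu2
    | .serve3 => (min (z.c - z.c1) (M.k3 - z.b1)).toNat * M.mu3
    | .serve4 => (min z.d (M.k4 - z.c1)).toNat * M.mu4
    | .serveUp1 => z.a1.toNat * M.muUp1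
    | .serveUp2 => z.b1.toNat * M.muUp2
    | .serveUp3 => z.c1.toNat * M.muUp3
    | .abandon1 => (max 0 (z.a - (M.k1 + z.a1))).toNat * M.theta1
    | .abandon2 => (max 0 (z.b - (M.k2 - z.a1 + z.b1))).toNat * M.theta2
    | .abandon3 => (max 0 (z.c - (M.k3 - z.b1 + z.c1))).toNat * M.theta3
    | .abandon4 => (max 0 (z.d - (M.k4 - z.c1))).toNat * M.theta4
  else 0

/-- The state to which an event leads from the state `z`. -/
def next (M : CallCentre) (n : Reservation) (z : State) : Event → State
  | .arrive1 => if z.total < M.cap then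
      ⟨z.a + 1, z.a1 + ind (z.a - z.a1 ≥ M.k1 ∧ z.b - z.b1 < M.k2 - n.n2 - z.a1),
        z.b, z.b1, z.c, z.c1, z.d⟩ else z
  | .arrive2 => if z.total < M.cap then
      ⟨z.a, z.a1,
        z.b + 1, z.b1 + ind (z.b - z.b1 ≥ M.k2 ∧ z.c - z.c1 < M.k3 - n.n3 - z.b1),
        z.c, z.c1, z.d⟩ else z
  | .arrive3 => if z.total < M.cap then
      ⟨z.a, z.a1, z.b, z.b1,
        z.c + 1, z.c1 + ind (z.c - z.c1 ≥ M.k3 ∧ z.d < M.k4 - n.n4 - z.c1), z.d⟩ else z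
  | .arrive4 => if z.total < M.cap then
      ⟨z.a, z.a1, z.b, z.b1, z.c, z.c1, z.d + 1⟩ else z
  | .serve1 => ⟨z.a - 1, z.a1, z.b, z.b1, z.c, z.c1, z.d⟩
  | .serveUp1 =>
      ⟨z.a - 1, z.a1 - (1 - ind (z.a - z.a1 > M.k1 ∧ z.b - z.b1 = M.k2 - n.n2 - z.a1)),
        z.b, z.b1, z.c, z.c1, z.d⟩
  | .serve2 =>
      ⟨z.a, z.a1 + ind (z.a - z.a1 > M.k1 ∧ z.b - z.b1 = M.k2 - n.n2 - z.a1),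
        z.b - 1, z.b1, z.c, z.c1, z.d⟩
  | .serveUp2 =>
      ⟨z.a, z.a1,
        z.b - 1, z.b1 - (1 - ind (z.b - z.b1 > M.k2 - z.a1 ∧ z.c = M.k3 - n.n3 - z.b1)),
        z.c, z.c1, z.d⟩
  | .serve3 =>
      ⟨z.a, z.a1,
        z.b, z.b1 + ind (z.b - z.b1 > M.k2 ∧ z.c - z.c1 = M.k3 - n.n3 - z.b1),
        z.c - 1, z.c1, z.d⟩
  | .serveUp3 =>
      ⟨z.a, z.a1, z.b, z.b1,
        z.c - 1, z.c1 - (1 - ind (z.c - z.c1 > M.k3 - z.b1 ∧ z.d = M.k4 - n.n4 - z.c1)), z.d⟩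
  | .serve4 =>
      ⟨z.a, z.a1, z.b, z.b1,
        z.c, z.c1 + ind (z.c - z.c1 > M.k3 - z.b1 ∧ z.d = M.k4 - n.n4 - z.c1), z.d - 1⟩
  | .abandon1 => ⟨z.a - 1, z.a1, z.b, z.b1, z.c, z.c1, z.d⟩
  | .abandon2 => ⟨z.a, z.a1, z.b - 1, z.b1, z.c, z.c1, z.d⟩
  | .abandon3 => ⟨z.a, z.a1, z.b, z.b1, z.c - 1, z.c1, z.d⟩
  | .abandon4 => ⟨z.a, z.a1, z.b, z.b1, z.c, z.c1, z.d - 1⟩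

/-- The cost of an event in the state `z`: `beta` for a blocked arrival, `gammaᵢ` for an
abandonment by a level `i` caller. -/
def cost (M : CallCentre) (z : State) : Event → ℝ
  | .arrive1 | .arrive2 | .arrive3 | .arrive4 => if z.total < M.cap then 0 else M.beta
  | .abandon1 => M.gamma1
  | .abandon2 => M.gamma2
  | .abandon3 => M.gamma3
  | .abandon4 => M.gamma4
  | _ => 0

/-- The total rate of events in the state `z`. -/
def totalRate (M : CallCentre) (n : Reservation) (z : State) : ℝ≥0 := ∑ e, rate M n z e

/-- The time until the next event in the state `z` is exponential with parameter `totalRate`, and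
infinite if that is zero. -/
def sojournLaw (M : CallCentre) (n : Reservation) (z : State) : Measure ℝ≥0∞ :=
  if totalRate M n z = 0 then Measure.dirac ⊤
  else (expMeasure (totalRate M n z)).map ENNReal.ofReal

instance (M : CallCentre) (n : Reservation) (z : State) :
    IsProbabilityMeasure (sojournLaw M n z) := by
  unfold sojournLaw
  split_ifs with h
  · infer_instance
  · have : IsProbabilityMeasure (expMeasure (totalRate M n z)) :=
      isProbabilityMeasure_expMeasure (by exact_mod_cast pos_iff_ne_zero.mpr h)
    exact Measure.isProbabilityMeasure_map ENNReal.measurable_ofReal.aemeasurable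

lemma tsum_rate (M : CallCentre) (n : Reservation) (z : State) :
    ∑' e, (rate M n z e : ℝ≥0∞) = totalRate M n z := by
  rw [tsum_fintype, totalRate, ENNReal.ofNNReal_finsetSum]

/-- The next event in the state `z` is `e` with probability `rate e / totalRate` (it never comes,
and an arbitrary label is used, if the total rate is zero). -/
def eventLaw (M : CallCentre) (n : Reservation) (z : State) : PMF Event :=
  if h : totalRate M n z = 0 then PMF.pure .arrive1
  else PMF.normalize (fun e => (rate M n z e : ℝ≥0∞))
    (by rw [tsum_rate]; exact_mod_cast h) (by rw [tsum_rate]; exact ENNReal.coe_ne_top)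

/-- One step of the process: the sojourn time before the next event, that event, and the state in
which it happens. -/
abbrev Step := ℝ≥0∞ × Event × State

/-- The law of the step that starts in the state `z`: sojourn time and event are independent. -/
def stepLaw (M : CallCentre) (n : Reservation) (z : State) : Measure Step :=
  (sojournLaw M n z).prod ((eventLaw M n z).toMeasure.prod (Measure.dirac z))

instance (M : CallCentre) (n : Reservation) (z : State) :
    IsProbabilityMeasure (stepLaw M n z) := by
  unfold stepLaw
  infer_instance

/-- The state after a step. -/
def stateAfter (M : CallCentre) (n : Reservation) (x : Step) : State := next M n x.2.2 x.2.1

lemma measurable_stateAfter (M : CallCentre) (n : Reservation) :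
    Measurable (stateAfter M n) :=
  (measurable_of_countable (fun y : Event × State => next M n y.2 y.1)).comp measurable_snd

/-- The Markov transition kernel: the next step starts in the state after the last one. -/
def stepKernel (M : CallCentre) (n : Reservation) (i : ℕ) :
    Kernel ((j : Finset.Iic i) → Step) Step :=
  (Kernel.ofFunOfCountable (stepLaw M n)).comap
    (fun h => stateAfter M n (h ⟨i, Finset.mem_Iic.mpr le_rfl⟩))
    ((measurable_stateAfter M n).comp (measurable_pi_apply _))

instance (M : CallCentre) (n : Reservation) (i : ℕ) : IsMarkovKernel (stepKernel M n i) := by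
  have : IsMarkovKernel (Kernel.ofFunOfCountable (stepLaw M n)) :=
    ⟨fun z => inferInstanceAs (IsProbabilityMeasure (stepLaw M n z))⟩
  unfold stepKernel
  infer_instance

/-- The law of the continuous-time Markov chain started in the state `z`, as the sequence of its
steps (jump chain, event labels and sojourn times). -/
def chainLaw (M : CallCentre) (n : Reservation) (z : State) : Measure (ℕ → Step) :=
  Kernel.trajMeasure (X := fun _ => Step) (stepLaw M n z) (stepKernel M n)

/-- The time of the event number `i` (the numbering starts with `0`). -/
def eventTime (ω : ℕ → Step) (i : ℕ) : ℝ≥0∞ := ∑ j ∈ Finset.range (i + 1), (ω j).1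

/-- The cost incurred by the event number `i` during the time interval `(0, t)`. -/
def costTerm (M : CallCentre) (t : ℝ) (ω : ℕ → Step) (i : ℕ) : ℝ :=
  if eventTime ω i < ENNReal.ofReal t then cost M (ω i).2.2 (ω i).2.1 else 0

/-- The cost of abandonments and losses during the time interval `(0, t)`. -/
def totalCost (M : CallCentre) (t : ℝ) (ω : ℕ → Step) : ℝ := ∑' i, costTerm M t ω i

/-- `A_z(n, t)`: the expected cost of abandonments and losses during the time interval `(0, t)`,
given that the state at time `0` is `z`. -/
def expectedCost (M : CallCentre) (n : Reservation) (z : State) (t : ℝ) : ℝ :=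
  ∫ ω, totalCost M t ω ∂(chainLaw M n z)

/-- The Laplace transform of a function on `(0, ∞)`. -/
def laplace (f : ℝ → ℝ) (s : ℂ) : ℂ := ∫ t in Set.Ioi (0 : ℝ), Complex.exp (-s * t) * f t

/-- The Laplace transform of `A_z(n, t)` in `t`. -/
def laplaceCost (M : CallCentre) (n : Reservation) (s : ℂ) (z : State) : ℂ :=
  laplace (expectedCost M n z) s

/-- The numerator `ξ`, in terms of a function `A` of the state. -/
def xi (M : CallCentre) (n : Reservation) (s : ℂ) (A : State → ℂ) : State → ℂ
  | ⟨a, a1, b, b1, c, c1, d⟩ =>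
    (M.lam1 * A ⟨a + 1, a1 + ind (a - a1 ≥ M.k1 ∧ b - b1 < M.k2 - n.n2 - a1), b, b1, c, c1, d⟩
      + M.lam2 * A ⟨a, a1, b + 1,
          b1 + ind (b - b1 ≥ M.k2 ∧ c - c1 < M.k3 - n.n3 - b1), c, c1, d⟩
      + M.lam3 * A ⟨a, a1, b, b1, c + 1, c1 + ind (c - c1 ≥ M.k3 ∧ d < M.k4 - n.n4 - c1), d⟩
      + M.lam4 * A ⟨a, a1, b, b1, c, c1, d + 1⟩) * ind (a + b + c + d < M.cap)
    + (min (M.k1 : ℤ) (a - a1) : ℤ) * M.mu1 * A ⟨a - 1, a1, b, b1, c, c1, d⟩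
    + a1 * M.muUp1 *
        A ⟨a - 1, a1 - (1 - ind (a - a1 > M.k1 ∧ b - b1 = M.k2 - n.n2 - a1)), b, b1, c, c1, d⟩
    + (min (b - b1) (M.k2 - a1) : ℤ) * M.mu2 *
        A ⟨a, a1 + ind (a - a1 > M.k1 ∧ b - b1 = M.k2 - n.n2 - a1), b - 1, b1, c, c1, d⟩
    + b1 * M.muUp2 *
        A ⟨a, a1, b - 1, b1 - (1 - ind (b - b1 > M.k2 - a1 ∧ c = M.k3 - n.n3 - b1)), c, c1, d⟩
    + (min (c - c1) (M.k3 - b1) : ℤ) * M.mu3 *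
        A ⟨a, a1, b, b1 + ind (b - b1 > M.k2 ∧ c - c1 = M.k3 - n.n3 - b1), c - 1, c1, d⟩
    + c1 * M.muUp3 *
        A ⟨a, a1, b, b1, c - 1, c1 - (1 - ind (c - c1 > M.k3 - b1 ∧ d = M.k4 - n.n4 - c1)), d⟩
    + (min d (M.k4 - c1) : ℤ) * M.mu4 *
        A ⟨a, a1, b, b1, c, c1 + ind (c - c1 > M.k3 - b1 ∧ d = M.k4 - n.n4 - c1), d - 1⟩
    + (max 0 (a - (M.k1 + a1)) : ℤ) * M.theta1 *
        (A ⟨a - 1, a1, b, b1, c, c1, d⟩ + M.gamma1 / s)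
    + (max 0 (b - (M.k2 - a1 + b1)) : ℤ) * M.theta2 *
        (A ⟨a, a1, b - 1, b1, c, c1, d⟩ + M.gamma2 / s)
    + (max 0 (c - (M.k3 - b1 + c1)) : ℤ) * M.theta3 *
        (A ⟨a, a1, b, b1, c - 1, c1, d⟩ + M.gamma3 / s)
    + (max 0 (d - (M.k4 - c1)) : ℤ) * M.theta4 *
        (A ⟨a, a1, b, b1, c, c1, d - 1⟩ + M.gamma4 / s)
    + (M.lam1 + M.lam2 + M.lam3 + M.lam4) * M.beta * ind (a + b + c + d = M.cap) / s

/-- The denominator `ψ`. -/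
def psi (M : CallCentre) (s : ℂ) : State → ℂ
  | ⟨a, a1, b, b1, c, c1, d⟩ =>
    (M.lam1 + M.lam2 + M.lam3 + M.lam4) * ind (a + b + c + d < M.cap)
    + (min (M.k1 : ℤ) (a - a1) : ℤ) * M.mu1 + a1 * M.muUp1
    + (min (b - b1) (M.k2 - a1) : ℤ) * M.mu2 + b1 * M.muUp2
    + (min (c - c1) (M.k3 - b1) : ℤ) * M.mu3 + c1 * M.muUp3
    + (min d (M.k4 - c1) : ℤ) * M.mu4
    + (max 0 (a - (M.k1 + a1)) : ℤ) * M.theta1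
    + (max 0 (b - (M.k2 - a1 + b1)) : ℤ) * M.theta2
    + (max 0 (c - (M.k3 - b1 + c1)) : ℤ) * M.theta3
    + (max 0 (d - (M.k4 - c1)) : ℤ) * M.theta4
    + s

end FourLevel

end

noncomputable section

/-!
The sequence of steps (waiting time, event) is a Markov renewal process, and the discount factor
`exp (-s τ)` is multiplicative in `τ`. So the discounted mean of the cost of the event number
`i + 1` is the discounted mean, over the first step, of that of the event number `i`. The total
rate is bounded, since `Ω` is finite; hence one step discounts by a factor that is bounded away
from `1` uniformly in the state, the discounted means decay geometrically in `i`, and their sum,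
which is `s` times the Laplace transform of the expected cost, satisfies the equation obtained by
conditioning on the first event. The Chernoff bound `1_{T < t} ≤ exp (σ (t - T))` with
`σ = Re s / 2` derives from the same decay the integrability needed to exchange sums and integrals.

Blocked arrivals leave the state unchanged. Their rates contribute equally to both sides of the
equation for the first event and cancel, which is why `ψ` contains the arrival rates only when the
system is not full.
-/

section TrajMeasure

variable {X : ℕ → Type*} [∀ n, MeasurableSpace (X n)]
  (μ₀ : Measure (X 0))
  (κ : (n : ℕ) → Kernel ((i : Finset.Iic n) → X i) (X (n + 1))) [∀ n, IsMarkovKernel (κ n)]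

lemma map_eval_zero_trajMeasure :
    (Kernel.trajMeasure μ₀ κ).map (fun ω => ω 0) = μ₀ := by
  let e : X 0 ≃ᵐ ((i : Finset.Iic 0) → X i) :=
    (MeasurableEquiv.piUnique fun i : Finset.Iic 0 => X i).symm
  let eval : ((i : Finset.Iic 0) → X i) → X 0 := fun x => x ⟨0, by simp⟩
  have measurable_eval : Measurable eval := measurable_pi_apply _
  have map_frestrictLe_zero :
      (Kernel.trajMeasure μ₀ κ).map (Preorder.frestrictLe 0) = μ₀.map e := by
    rw [Kernel.trajMeasure, Measure.map_comp _ _ (by fun_prop), Kernel.traj_map_frestrictLe,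
      Kernel.partialTraj_self, Measure.id_comp]
    rfl
  calc (Kernel.trajMeasure μ₀ κ).map (fun ω => ω 0)
      = ((Kernel.trajMeasure μ₀ κ).map (Preorder.frestrictLe 0)).map eval :=
        (Measure.map_map measurable_eval (Preorder.measurable_frestrictLe 0)).symm
    _ = (μ₀.map e).map eval := by rw [map_frestrictLe_zero]
    _ = μ₀.map (eval ∘ e) := Measure.map_map measurable_eval e.measurable
    _ = μ₀ := Measure.map_id

lemma integral_trajMeasure_succ [IsProbabilityMeasure μ₀] {E : Type*} [NormedAddCommGroup E]
    [NormedSpace ℝ E] (n : ℕ) {f : ((i : Finset.Iic n) → X i) × X (n + 1) → E}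
    (hf : StronglyMeasurable f)
    (hint : Integrable (fun ω => f (Preorder.frestrictLe n ω, ω (n + 1)))
      (Kernel.trajMeasure μ₀ κ)) :
    ∫ ω, f (Preorder.frestrictLe n ω, ω (n + 1)) ∂(Kernel.trajMeasure μ₀ κ) =
      ∫ ω, ∫ x, f (Preorder.frestrictLe n ω, x) ∂(κ n (Preorder.frestrictLe n ω))
        ∂(Kernel.trajMeasure μ₀ κ) := by
  have hmeas : Measurable fun ω : (n : ℕ) → X n => (Preorder.frestrictLe n ω, ω (n + 1)) := by
    fun_prop
  rw [← integral_map hmeas.aemeasurable hf.aestronglyMeasurable,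
    ← Kernel.map_frestrictLe_trajMeasure_compProd_eq_map_trajMeasure, Measure.integral_compProd,
    integral_map (by fun_prop) hf.integral_kernel_prod_right'.aestronglyMeasurable]
  rwa [Kernel.map_frestrictLe_trajMeasure_compProd_eq_map_trajMeasure,
    integrable_map_measure hf.aestronglyMeasurable hmeas.aemeasurable]

end TrajMeasure

section IntegralTsum

variable {α E ι : Type*} [MeasurableSpace α] {μ : Measure α} [NormedAddCommGroup E]
  {F : ι → α → E}

lemma integrable_and_summable_integral_norm_of_norm_le {g : ι → α → ℝ}
    (hF : ∀ i, AEStronglyMeasurable (F i) μ) (hg : ∀ i, Integrable (g i) μ)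
    (hFg : ∀ i a, ‖F i a‖ ≤ g i a) (hsum : Summable fun i => ∫ a, g i a ∂μ) :
    (∀ i, Integrable (F i) μ) ∧ Summable fun i => ∫ a, ‖F i a‖ ∂μ := by
  have hint i : Integrable (F i) μ := (hg i).mono' (hF i) (.of_forall (hFg i))
  exact ⟨hint, hsum.of_nonneg_of_le (fun i => integral_nonneg fun _ => norm_nonneg _)
    fun i => integral_mono (hint i).norm (hg i) (hFg i)⟩

variable [Countable ι]

lemma lintegral_tsum_enorm_ne_top (hF : ∀ i, Integrable (F i) μ)
    (hsum : Summable fun i => ∫ a, ‖F i a‖ ∂μ) : ∫⁻ a, ∑' i, ‖F i a‖ₑ ∂μ ≠ ⊤ := by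
  rw [lintegral_tsum fun i => (hF i).1.enorm]
  simpa only [ofReal_integral_norm_eq_lintegral_enorm (hF _)] using hsum.tsum_ofReal_ne_top

variable [CompleteSpace E]

lemma ae_summable_of_summable_integral_norm (hF : ∀ i, Integrable (F i) μ)
    (hsum : Summable fun i => ∫ a, ‖F i a‖ ∂μ) : ∀ᵐ a ∂μ, Summable fun i => F i a := by
  filter_upwards [ae_lt_top' (AEMeasurable.tsum fun i => (hF i).1.enorm)
    (lintegral_tsum_enorm_ne_top hF hsum)] with a ha
  exact .of_norm (NNReal.summable_coe.mpr (ENNReal.tsum_coe_ne_top_iff_summable.mp ha.ne))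

lemma integrable_tsum_of_summable_integral_norm {F : ℕ → α → E} (hF : ∀ i, Integrable (F i) μ)
    (hsum : Summable fun i => ∫ a, ‖F i a‖ ∂μ) : Integrable (fun a => ∑' i, F i a) μ := by
  refine ⟨aestronglyMeasurable_of_tendsto_ae Filter.atTop
    (fun k => Finset.aestronglyMeasurable_fun_sum (Finset.range k) fun i _ => (hF i).1) ?_,
    (lintegral_mono fun a => enorm_tsum_le_tsum_enorm).trans_lt
      (lintegral_tsum_enorm_ne_top hF hsum).lt_top⟩
  filter_upwards [ae_summable_of_summable_integral_norm hF hsum] with a ha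
  exact ha.hasSum.tendsto_sum_nat

end IntegralTsum

section Discount

/-- The discount factor `exp (-s τ)` of a time `τ`, in Laplace transforms at `s`. It is zero for
`τ = ∞`, so that what never happens does not count. -/
def discount (s : ℂ) (τ : ℝ≥0∞) : ℂ := if τ = ⊤ then 0 else Complex.exp (-s * τ.toReal)

@[simp]
lemma discount_top (s : ℂ) : discount s ⊤ = 0 := if_pos rfl

lemma discount_ofReal (s : ℂ) {t : ℝ} (ht : 0 ≤ t) :
    discount s (ENNReal.ofReal t) = Complex.exp (-s * t) := by
  rw [discount, if_neg ENNReal.ofReal_ne_top, ENNReal.toReal_ofReal ht]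

lemma discount_add (s : ℂ) (τ υ : ℝ≥0∞) :
    discount s (τ + υ) = discount s τ * discount s υ := by
  by_cases hτ : τ = ⊤
  · simp [hτ]
  by_cases hυ : υ = ⊤
  · simp [hυ]
  simp only [discount, ENNReal.add_eq_top, hτ, hυ, or_self, if_false, ENNReal.toReal_add hτ hυ,
    Complex.ofReal_add, mul_add, Complex.exp_add]

@[fun_prop]
lemma measurable_discount (s : ℂ) : Measurable (discount s) :=
  Measurable.ite (measurableSet_singleton ⊤) measurable_const (by fun_prop)

lemma norm_discount (s : ℂ) (τ : ℝ≥0∞) :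
    ‖discount s τ‖ = if τ = ⊤ then 0 else Real.exp (-s.re * τ.toReal) := by
  unfold discount
  split_ifs <;> simp [Complex.norm_exp]

lemma discount_re (s : ℂ) (τ : ℝ≥0∞) : discount s.re τ = ‖discount s τ‖ := by
  rw [norm_discount, discount]
  split_ifs <;> simp

lemma norm_discount_le_one {s : ℂ} (hs : 0 ≤ s.re) (τ : ℝ≥0∞) : ‖discount s τ‖ ≤ 1 := by
  rw [norm_discount]
  split_ifs
  · exact zero_le_one
  · exact Real.exp_le_one_iff.mpr
      (mul_nonpos_of_nonpos_of_nonneg (neg_nonpos.mpr hs) ENNReal.toReal_nonneg)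

lemma norm_discount_mul_le {s v : ℂ} {τ : ℝ≥0∞} {C : ℝ} (hs : 0 ≤ s.re) (hv : ‖v‖ ≤ C) :
    ‖discount s τ * v‖ ≤ C := by
  rw [norm_mul]
  exact (mul_le_of_le_one_left (norm_nonneg v) (norm_discount_le_one hs τ)).trans hv

lemma one_le_exp_mul_norm_discount {s : ℂ} (hs : 0 ≤ s.re) {τ : ℝ≥0∞} {t : ℝ}
    (h : τ < ENNReal.ofReal t) : 1 ≤ Real.exp (s.re * t) * ‖discount s τ‖ := by
  have hτ : τ.toReal ≤ t := ((ENNReal.lt_ofReal_iff_toReal_lt h.ne_top).mp h).le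
  rw [norm_discount, if_neg h.ne_top, ← Real.exp_add, Real.one_le_exp_iff, neg_mul,
    ← sub_eq_add_neg, sub_nonneg]
  gcongr

lemma integral_exp_of_lt_ofReal {s : ℂ} (hs : 0 < s.re) (τ : ℝ≥0∞) :
    ∫ t in Set.Ioi (0 : ℝ), (if τ < ENNReal.ofReal t then Complex.exp (-s * t) else 0) =
      discount s τ / s := by
  by_cases hτ : τ = ⊤
  · simp [hτ]
  have integrand_eq : (fun t : ℝ => if τ < ENNReal.ofReal t then Complex.exp (-s * t) else 0) =
      (Set.Ioi τ.toReal).indicator fun t : ℝ => Complex.exp (-s * t) := by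
    ext t
    simp only [Set.indicator_apply, ENNReal.lt_ofReal_iff_toReal_lt hτ, Set.mem_Ioi]
  rw [integrand_eq, setIntegral_indicator measurableSet_Ioi,
    Set.inter_eq_right.mpr (Set.Ioi_subset_Ioi ENNReal.toReal_nonneg),
    integral_exp_mul_complex_Ioi (by simpa using hs), discount, if_neg hτ, neg_div_neg_eq]

lemma integral_discount_expMeasure {r : ℝ} (hr : 0 < r) {s : ℂ} (hs : -r < s.re) :
    ∫ x, discount s (ENNReal.ofReal x) ∂(expMeasure r) = r / (r + s) := by
  have hre : (-(r + s)).re < 0 := by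
    rw [Complex.neg_re, Complex.add_re, Complex.ofReal_re]
    linarith
  have hdensity (x : ℝ) : (exponentialPDF r x).toReal • discount s (ENNReal.ofReal x) =
      (Set.Ici (0 : ℝ)).indicator (fun x : ℝ => (r : ℂ) * Complex.exp (-(r + s) * x)) x := by
    by_cases hx : 0 ≤ x
    · rw [Set.indicator_of_mem (Set.mem_Ici.mpr hx), exponentialPDF_of_nonneg hx,
        ENNReal.toReal_ofReal (by positivity), discount_ofReal s hx, Complex.real_smul]
      push_cast
      rw [mul_assoc, ← Complex.exp_add]
      ring_nf
    · rw [Set.indicator_of_notMem (by simpa using hx), exponentialPDF_of_neg (not_le.mp hx),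
        ENNReal.toReal_zero, zero_smul]
  rw [show expMeasure r = volume.withDensity (exponentialPDF r) from rfl,
    integral_withDensity_eq_integral_toReal_smul
      (show Measurable (exponentialPDF r) from (measurable_exponentialPDFReal r).ennreal_ofReal)
      (by simp [exponentialPDF])]
  simp_rw [hdensity]
  rw [integral_indicator measurableSet_Ici, integral_Ici_eq_integral_Ioi, integral_const_mul,
    integral_exp_mul_complex_Ioi hre, Complex.ofReal_zero, mul_zero, Complex.exp_zero,
    neg_div_neg_eq, mul_one_div]

end Discount

/-- A Markov renewal process with states in `S` and steps in `X`: from a state `z` it makes a step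
with law `stepLaw z`, which takes the time `duration` (possibly infinite) and leads to the state
`endState`. -/
structure MarkovRenewal (S X : Type*) [MeasurableSpace S] [MeasurableSpace X] where
  stepLaw : Kernel S X
  isMarkovKernel_stepLaw : IsMarkovKernel stepLaw
  endState : X → S
  measurable_endState : Measurable endState
  duration : X → ℝ≥0∞
  measurable_duration : Measurable duration

namespace MarkovRenewal

attribute [instance] isMarkovKernel_stepLaw
attribute [fun_prop] measurable_endState measurable_duration

variable {S X : Type*} [MeasurableSpace S] [MeasurableSpace X] (R : MarkovRenewal S X)

/-- The law of the step number `i + 1` given the steps number `0, …, i`. -/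
def stepKernel (i : ℕ) : Kernel (Finset.Iic i → X) X :=
  R.stepLaw.comap (fun h => R.endState (h ⟨i, Finset.mem_Iic.mpr le_rfl⟩)) (by fun_prop)

instance (i : ℕ) : IsMarkovKernel (R.stepKernel i) := by
  unfold stepKernel
  infer_instance

/-- The law of the sequence of steps of the process started in the state `z`. -/
def trajLaw (z : S) : Measure (ℕ → X) :=
  Kernel.trajMeasure (X := fun _ => X) (R.stepLaw z) R.stepKernel

instance (z : S) : IsProbabilityMeasure (R.trajLaw z) := by
  unfold trajLaw
  infer_instance

/-- The time at which the step number `i` ends. -/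
def eventTime (ω : ℕ → X) (i : ℕ) : ℝ≥0∞ := ∑ j ∈ Finset.range (i + 1), R.duration (ω j)

@[fun_prop]
lemma measurable_eventTime (i : ℕ) : Measurable fun ω => R.eventTime ω i := by
  unfold eventTime
  fun_prop

/-- The mean of a quantity `w` over one step from the state `z`, discounted to the beginning of
the step. -/
def discountedStep (s : ℂ) (w : X → ℂ) (z : S) : ℂ :=
  ∫ x, discount s (R.duration x) * w x ∂(R.stepLaw z)

/-- The mean of a quantity `w` over the step number `i` of the process started in the state `z`,
discounted to time `0`. -/
def discountedMean (s : ℂ) (w : X → ℂ) (i : ℕ) (z : S) : ℂ :=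
  ∫ ω, discount s (R.eventTime ω i) * w (ω i) ∂(R.trajLaw z)

section Recursion

variable {s : ℂ} {w : X → ℂ} {C : ℝ}

lemma measurable_discountedStep (hw : Measurable w) : Measurable (R.discountedStep s w) :=
  StronglyMeasurable.measurable (StronglyMeasurable.integral_kernel
    (f := fun x => discount s (R.duration x) * w x) (by fun_prop))

lemma discountedMean_zero (hw : Measurable w) (z : S) :
    R.discountedMean s w 0 z = R.discountedStep s w z := by
  rw [discountedStep, ← map_eval_zero_trajMeasure (X := fun _ => X) (R.stepLaw z) R.stepKernel,
    integral_map (measurable_pi_apply 0).aemeasurable (by fun_prop)]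
  simp only [discountedMean, eventTime, zero_add, Finset.sum_range_one, trajLaw]

lemma discountedMean_succ (hs : 0 ≤ s.re) (hw : Measurable w) (hC : ∀ x, ‖w x‖ ≤ C) (i : ℕ)
    (z : S) : R.discountedMean s w (i + 1) z =
      R.discountedMean s (R.discountedStep s w ∘ R.endState) i z := by
  let f : (Finset.Iic i → X) × X → ℂ := fun p =>
    discount s (∑ j, R.duration (p.1 j)) * (discount s (R.duration p.2) * w p.2)
  have hf : Measurable f := by fun_prop
  have eventTime_eq (ω : ℕ → X) :
      R.eventTime ω i = ∑ j : Finset.Iic i, R.duration (Preorder.frestrictLe i ω j) := by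
    rw [eventTime, Nat.range_succ_eq_Iic]
    exact (Finset.sum_coe_sort _ fun j => R.duration (ω j)).symm
  have integrand_eq (ω : ℕ → X) : discount s (R.eventTime ω (i + 1)) * w (ω (i + 1)) =
      f (Preorder.frestrictLe i ω, ω (i + 1)) := by
    simp only [f, ← eventTime_eq, ← mul_assoc, ← discount_add]
    rw [eventTime, Finset.sum_range_succ, ← eventTime]
  simp only [discountedMean, integrand_eq]
  rw [trajLaw, integral_trajMeasure_succ (X := fun _ => X) _ _ i hf.stronglyMeasurable]
  · simp only [f, integral_const_mul, ← eventTime_eq]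
    rfl
  · exact .of_bound (hf.comp (by fun_prop)).aestronglyMeasurable C (.of_forall fun ω =>
      norm_discount_mul_le hs (norm_discount_mul_le hs (hC _)))

lemma norm_discountedStep_le (hs : 0 ≤ s.re) (hC : ∀ x, ‖w x‖ ≤ C) (z : S) :
    ‖R.discountedStep s w z‖ ≤ C := by
  simpa [discountedStep] using norm_integral_le_of_norm_le_const (μ := R.stepLaw z)
    (.of_forall fun x => norm_discount_mul_le hs (hC x))

lemma discountedMean_succ_eq_discountedStep (hs : 0 ≤ s.re) (hw : Measurable w)
    (hC : ∀ x, ‖w x‖ ≤ C) (i : ℕ) :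
    R.discountedMean s w (i + 1) = R.discountedStep s (R.discountedMean s w i ∘ R.endState) := by
  have measurable_next : Measurable (R.discountedStep s w ∘ R.endState) :=
    (R.measurable_discountedStep hw).comp R.measurable_endState
  induction i generalizing w with
  | zero =>
    ext z
    rw [R.discountedMean_succ hs hw hC, R.discountedMean_zero measurable_next,
      show R.discountedMean s w 0 = R.discountedStep s w from funext (R.discountedMean_zero hw)]
  | succ i ih =>
    have next_eq : R.discountedMean s w (i + 1) =
        R.discountedMean s (R.discountedStep s w ∘ R.endState) i :=
      funext (R.discountedMean_succ hs hw hC i)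
    ext z
    rw [R.discountedMean_succ hs hw hC, next_eq, ih measurable_next
      (fun x => R.norm_discountedStep_le hs hC _)
      ((R.measurable_discountedStep measurable_next).comp R.measurable_endState)]

lemma measurable_discountedMean (hs : 0 ≤ s.re) (hw : Measurable w) (hC : ∀ x, ‖w x‖ ≤ C)
    (i : ℕ) : Measurable (R.discountedMean s w i) := by
  induction i with
  | zero =>
    rw [funext (R.discountedMean_zero hw)]
    exact R.measurable_discountedStep hw
  | succ i ih =>
    rw [R.discountedMean_succ_eq_discountedStep hs hw hC]
    exact R.measurable_discountedStep (ih.comp R.measurable_endState)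

end Recursion

/-- At every `s` in the right half-plane one step discounts uniformly in the starting state. This
is what makes the discounted means summable, and excludes explosion. -/
def UniformlyDiscounting : Prop :=
  ∀ s : ℂ, 0 < s.re → ∃ ρ < 1, ∀ z, ∫ x, ‖discount s (R.duration x)‖ ∂(R.stepLaw z) ≤ ρ

section Contraction

variable {R} {s : ℂ} {w : X → ℂ} {C ρ : ℝ}

lemma integrable_discount_duration (hs : 0 ≤ s.re) (z : S) :
    Integrable (fun x => discount s (R.duration x)) (R.stepLaw z) :=
  .of_bound (Measurable.aestronglyMeasurable (by fun_prop)) 1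
    (.of_forall fun _ => norm_discount_le_one hs _)

lemma integrable_discount_eventTime (hs : 0 ≤ s.re) (z : S) (i : ℕ) :
    Integrable (fun ω => discount s (R.eventTime ω i)) (R.trajLaw z) :=
  .of_bound (Measurable.aestronglyMeasurable (by fun_prop)) 1
    (.of_forall fun _ => norm_discount_le_one hs _)

lemma norm_discountedStep_le_mul (hs : 0 ≤ s.re)
    (hρ : ∀ z, ∫ x, ‖discount s (R.duration x)‖ ∂(R.stepLaw z) ≤ ρ) (hC : ∀ x, ‖w x‖ ≤ C)
    (z : S) : ‖R.discountedStep s w z‖ ≤ C * ρ := by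
  obtain ⟨x⟩ := (R.stepLaw z).nonempty_of_neZero
  have hC₀ : 0 ≤ C := (norm_nonneg _).trans (hC x)
  calc ‖R.discountedStep s w z‖ ≤ ∫ x, ‖discount s (R.duration x)‖ * C ∂(R.stepLaw z) :=
        norm_integral_le_of_norm_le ((integrable_discount_duration hs z).norm.mul_const C)
          (.of_forall fun x => by rw [norm_mul]; gcongr; exact hC x)
    _ = C * ∫ x, ‖discount s (R.duration x)‖ ∂(R.stepLaw z) := by rw [integral_mul_const, mul_comm]
    _ ≤ C * ρ := by gcongr; exact hρ z

lemma norm_discountedMean_le (hs : 0 ≤ s.re)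
    (hρ : ∀ z, ∫ x, ‖discount s (R.duration x)‖ ∂(R.stepLaw z) ≤ ρ) (hw : Measurable w)
    (hC : ∀ x, ‖w x‖ ≤ C) (i : ℕ) (z : S) :
    ‖R.discountedMean s w i z‖ ≤ C * ρ ^ (i + 1) := by
  induction i generalizing z with
  | zero =>
    rw [R.discountedMean_zero hw, zero_add, pow_one]
    exact norm_discountedStep_le_mul hs hρ hC z
  | succ i ih =>
    rw [R.discountedMean_succ_eq_discountedStep hs hw hC, pow_succ, ← mul_assoc]
    exact norm_discountedStep_le_mul hs hρ (fun x => ih (R.endState x)) z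

lemma UniformlyDiscounting.exists_geometric_bound (hR : R.UniformlyDiscounting) (hs : 0 < s.re) :
    ∃ ρ, 0 ≤ ρ ∧ ρ < 1 ∧ ∀ w : X → ℂ, Measurable w → ∀ C, (∀ x, ‖w x‖ ≤ C) →
      ∀ i z, ‖R.discountedMean s w i z‖ ≤ C * ρ ^ (i + 1) := by
  obtain ⟨ρ, hρ₁, hρ⟩ := hR s hs
  exact ⟨max 0 ρ, le_max_left 0 ρ, max_lt zero_lt_one hρ₁, fun w hw C hC i z =>
    norm_discountedMean_le hs.le (fun z => (hρ z).trans (le_max_right 0 ρ)) hw hC i z⟩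

lemma UniformlyDiscounting.summable_integral_norm_discount_eventTime
    (hR : R.UniformlyDiscounting) (hs : 0 < s.re) (z : S) :
    Summable fun i => ∫ ω, ‖discount s (R.eventTime ω i)‖ ∂(R.trajLaw z) := by
  obtain ⟨ρ, hρ₀, hρ₁, hρ⟩ := hR.exists_geometric_bound (s := s.re) (by simpa using hs)
  have norm_eq (i : ℕ) : ∫ ω, ‖discount s (R.eventTime ω i)‖ ∂(R.trajLaw z) =
      ‖R.discountedMean s.re (fun _ => 1) i z‖ := by
    simp only [discountedMean, discount_re, mul_one, integral_complex_ofReal, Complex.norm_real]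
    exact (Real.norm_of_nonneg (integral_nonneg fun _ => norm_nonneg _)).symm
  refine .of_nonneg_of_le (fun i => integral_nonneg fun _ => norm_nonneg _) (fun i => ?_)
    ((summable_nat_add_iff 1).mpr (summable_geometric_of_lt_one hρ₀ hρ₁))
  rw [norm_eq]
  simpa using hρ (fun _ => 1) measurable_const 1 (by simp) i z

lemma UniformlyDiscounting.tsum_discountedMean (hR : R.UniformlyDiscounting) (hs : 0 < s.re)
    (hw : Measurable w) (hC : ∀ x, ‖w x‖ ≤ C) (z : S) :
    ∑' i, R.discountedMean s w i z =
      R.discountedStep s (fun x => w x + ∑' i, R.discountedMean s w i (R.endState x)) z := by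
  obtain ⟨ρ, hρ₀, hρ₁, hρ⟩ := hR.exists_geometric_bound hs
  have summable_geometric : Summable fun i => C * ρ ^ (i + 1) :=
    ((summable_nat_add_iff 1).mpr (summable_geometric_of_lt_one hρ₀ hρ₁)).mul_left C
  have summable_discountedMean : Summable fun i => R.discountedMean s w i z :=
    .of_norm_bounded summable_geometric fun i => hρ w hw C hC i z
  let F : ℕ → X → ℂ := fun i x =>
    discount s (R.duration x) * R.discountedMean s w i (R.endState x)
  have measurable_F (i : ℕ) : Measurable (F i) := by
    have := (R.measurable_discountedMean hs.le hw hC i).comp R.measurable_endState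
    fun_prop
  obtain ⟨hF, hFsum⟩ := integrable_and_summable_integral_norm_of_norm_le (μ := R.stepLaw z)
    (F := F) (fun i => (measurable_F i).aestronglyMeasurable)
    (fun i => integrable_const (C * ρ ^ (i + 1)))
    (fun i x => norm_discount_mul_le hs.le (hρ w hw C hC i _)) (by simpa using summable_geometric)
  have integrable_first : Integrable (fun x => discount s (R.duration x) * w x) (R.stepLaw z) :=
    .of_bound (Measurable.aestronglyMeasurable (by fun_prop)) C
      (.of_forall fun x => norm_discount_mul_le hs.le (hC x))
  calc ∑' i, R.discountedMean s w i z
      = R.discountedStep s w z + ∑' i, ∫ x, F i x ∂(R.stepLaw z) := by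
        rw [summable_discountedMean.tsum_eq_zero_add, R.discountedMean_zero hw]
        simp only [R.discountedMean_succ_eq_discountedStep hs.le hw hC]
        rfl
    _ = R.discountedStep s w z + ∫ x, ∑' i, F i x ∂(R.stepLaw z) := by
        rw [integral_tsum_of_summable_integral_norm hF hFsum]
    _ = _ := by
        rw [discountedStep, ← integral_add integrable_first
          (integrable_tsum_of_summable_integral_norm hF hFsum)]
        simp only [F, tsum_mul_left, ← mul_add, discountedStep]

end Contraction

section Reward

variable (c : X → ℝ) {s : ℂ} {C : ℝ}

/-- The reward `c` of the step number `i`, if that step ends during the time interval `(0, t)`. -/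
def rewardTerm (t : ℝ) (ω : ℕ → X) (i : ℕ) : ℝ :=
  if R.eventTime ω i < ENNReal.ofReal t then c (ω i) else 0

/-- The expected total of the rewards `c` of the steps that end during the time interval `(0, t)`,
for the process started in the state `z`. -/
def expectedReward (z : S) (t : ℝ) : ℝ := ∫ ω, ∑' i, R.rewardTerm c t ω i ∂(R.trajLaw z)

/-- The integrand of the Laplace transform at `s` of the reward of the step number `i`, as a
function of the time and the trajectory. -/
def laplaceTerm (s : ℂ) (i : ℕ) (p : ℝ × (ℕ → X)) : ℂ :=
  Complex.exp (-s * p.1) * R.rewardTerm c p.1 p.2 i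

variable {c}

@[fun_prop]
lemma measurable_rewardTerm (hc : Measurable c) (i : ℕ) :
    Measurable fun p : ℝ × (ℕ → X) => R.rewardTerm c p.1 p.2 i :=
  Measurable.ite (measurableSet_lt (by fun_prop) (by fun_prop)) (by fun_prop) measurable_const

lemma measurable_laplaceTerm (hc : Measurable c) (i : ℕ) :
    Measurable (R.laplaceTerm c s i) := by
  unfold laplaceTerm
  fun_prop

lemma abs_rewardTerm_le (hs : 0 ≤ s.re) (hC : ∀ x, |c x| ≤ C) (t : ℝ) (ω : ℕ → X) (i : ℕ) :
    |R.rewardTerm c t ω i| ≤ C * (Real.exp (s.re * t) * ‖discount s (R.eventTime ω i)‖) := by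
  have hC₀ : 0 ≤ C := (abs_nonneg _).trans (hC (ω i))
  unfold rewardTerm
  split_ifs with h
  · exact (hC _).trans (le_mul_of_one_le_right hC₀ (one_le_exp_mul_norm_discount hs h))
  · rw [abs_zero]
    positivity

variable {R}

lemma UniformlyDiscounting.integrable_and_summable_rewardTerm (hR : R.UniformlyDiscounting)
    (hc : Measurable c) (hC : ∀ x, |c x| ≤ C) (z : S) (t : ℝ) :
    (∀ i, Integrable (fun ω => R.rewardTerm c t ω i) (R.trajLaw z)) ∧
      Summable fun i => ∫ ω, ‖R.rewardTerm c t ω i‖ ∂(R.trajLaw z) := by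
  have one_re_pos : 0 < (1 : ℂ).re := by simp
  refine integrable_and_summable_integral_norm_of_norm_le
    (fun i => ((R.measurable_rewardTerm hc i).comp measurable_prodMk_left).aestronglyMeasurable)
    (fun i => ((integrable_discount_eventTime one_re_pos.le z i).norm.const_mul _).const_mul _)
    (fun i ω => R.abs_rewardTerm_le one_re_pos.le hC t ω i) ?_
  simp only [integral_const_mul]
  exact ((hR.summable_integral_norm_discount_eventTime one_re_pos z).mul_left _).mul_left _

lemma UniformlyDiscounting.ae_summable_rewardTerm (hR : R.UniformlyDiscounting)
    (hc : Measurable c) (hC : ∀ x, |c x| ≤ C) (z : S) (t : ℝ) :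
    ∀ᵐ ω ∂(R.trajLaw z), Summable fun i => R.rewardTerm c t ω i :=
  have ⟨hint, hsum⟩ := hR.integrable_and_summable_rewardTerm hc hC z t
  ae_summable_of_summable_integral_norm hint hsum

lemma UniformlyDiscounting.integrable_tsum_rewardTerm (hR : R.UniformlyDiscounting)
    (hc : Measurable c) (hC : ∀ x, |c x| ≤ C) (z : S) (t : ℝ) :
    Integrable (fun ω => ∑' i, R.rewardTerm c t ω i) (R.trajLaw z) :=
  have ⟨hint, hsum⟩ := hR.integrable_and_summable_rewardTerm hc hC z t
  integrable_tsum_of_summable_integral_norm hint hsum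

lemma UniformlyDiscounting.integrable_and_summable_laplaceTerm (hR : R.UniformlyDiscounting)
    (hs : 0 < s.re) (hc : Measurable c) (hC : ∀ x, |c x| ≤ C) (z : S) :
    (∀ i, Integrable (R.laplaceTerm c s i)
      ((volume.restrict (Set.Ioi (0 : ℝ))).prod (R.trajLaw z))) ∧
      Summable fun i => ∫ p, ‖R.laplaceTerm c s i p‖
        ∂((volume.restrict (Set.Ioi (0 : ℝ))).prod (R.trajLaw z)) := by
  have half_re : (s / 2).re = s.re / 2 := by simp
  have half_re_pos : 0 < (s / 2).re := by rw [half_re]; exact half_pos hs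
  -- Half of the decay of `exp (-s t)` pays for the Chernoff bound at `s / 2`.
  have norm_le (i : ℕ) (p : ℝ × (ℕ → X)) : ‖R.laplaceTerm c s i p‖ ≤
      C * Real.exp (-(s.re / 2) * p.1) * ‖discount (s / 2) (R.eventTime p.2 i)‖ := by
    calc ‖R.laplaceTerm c s i p‖
        = Real.exp (-s.re * p.1) * |R.rewardTerm c p.1 p.2 i| := by
          simp [laplaceTerm, Complex.norm_exp]
      _ ≤ Real.exp (-s.re * p.1) *
          (C * (Real.exp (s.re / 2 * p.1) * ‖discount (s / 2) (R.eventTime p.2 i)‖)) := by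
          gcongr
          simpa only [half_re] using R.abs_rewardTerm_le half_re_pos.le hC p.1 p.2 i
      _ = _ := by
          rw [show -(s.re / 2) * p.1 = -s.re * p.1 + s.re / 2 * p.1 by ring, Real.exp_add]
          ring
  have integrable_exp : IntegrableOn (fun t => C * Real.exp (-(s.re / 2) * t)) (Set.Ioi 0) :=
    (exp_neg_integrableOn_Ioi 0 (half_re ▸ half_re_pos)).const_mul C
  refine integrable_and_summable_integral_norm_of_norm_le
    (fun i => (R.measurable_laplaceTerm hc i).aestronglyMeasurable)
    (fun i => integrable_exp.mul_prod (integrable_discount_eventTime half_re_pos.le z i).norm)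
    norm_le ?_
  exact ((hR.summable_integral_norm_discount_eventTime half_re_pos z).mul_left
    (∫ t in Set.Ioi (0 : ℝ), C * Real.exp (-(s.re / 2) * t))).congr
    fun i => (integral_prod_mul (fun t => C * Real.exp (-(s.re / 2) * t)) _).symm

lemma integral_tsum_laplaceTerm (z : S) (t : ℝ) :
    ∫ ω, ∑' i, R.laplaceTerm c s i (t, ω) ∂(R.trajLaw z) =
      Complex.exp (-s * t) * R.expectedReward c z t := by
  simp only [laplaceTerm, tsum_mul_left, ← Complex.ofReal_tsum, integral_const_mul,
    integral_complex_ofReal, expectedReward]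

lemma UniformlyDiscounting.integrableOn_exp_mul_expectedReward (hR : R.UniformlyDiscounting)
    (hs : 0 < s.re) (hc : Measurable c) (hC : ∀ x, |c x| ≤ C) (z : S) :
    IntegrableOn (fun t : ℝ => Complex.exp (-s * t) * (R.expectedReward c z t : ℂ))
      (Set.Ioi 0) := by
  obtain ⟨hint, hsum⟩ := hR.integrable_and_summable_laplaceTerm hs hc hC z
  have integrable_integral :=
    (integrable_tsum_of_summable_integral_norm hint hsum).integral_prod_left
  simpa only [IntegrableOn, integral_tsum_laplaceTerm] using integrable_integral

lemma setIntegral_laplaceTerm (hs : 0 < s.re) (i : ℕ) (ω : ℕ → X) :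
    ∫ t in Set.Ioi (0 : ℝ), R.laplaceTerm c s i (t, ω) =
      discount s (R.eventTime ω i) * c (ω i) / s := by
  have integrand_eq (t : ℝ) : R.laplaceTerm c s i (t, ω) =
      (if R.eventTime ω i < ENNReal.ofReal t then Complex.exp (-s * t) else 0) * c (ω i) := by
    unfold laplaceTerm rewardTerm
    split_ifs <;> simp
  simp only [integrand_eq]
  rw [integral_mul_const, integral_exp_of_lt_ofReal hs, div_mul_eq_mul_div]

lemma UniformlyDiscounting.laplace_expectedReward (hR : R.UniformlyDiscounting)
    (hs : 0 < s.re) (hc : Measurable c) (hC : ∀ x, |c x| ≤ C) (z : S) :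
    FourLevel.laplace (R.expectedReward c z) s =
      (∑' i, R.discountedMean s (fun x => c x) i z) / s := by
  obtain ⟨hint, hsum⟩ := hR.integrable_and_summable_laplaceTerm hs hc hC z
  calc FourLevel.laplace (R.expectedReward c z) s
      = ∫ t in Set.Ioi (0 : ℝ), ∫ ω, ∑' i, R.laplaceTerm c s i (t, ω) ∂(R.trajLaw z) := by
        simp only [FourLevel.laplace, integral_tsum_laplaceTerm]
    _ = ∫ p, ∑' i, R.laplaceTerm c s i p
          ∂((volume.restrict (Set.Ioi (0 : ℝ))).prod (R.trajLaw z)) :=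
        (integral_prod _ (integrable_tsum_of_summable_integral_norm hint hsum)).symm
    _ = ∑' i, ∫ p, R.laplaceTerm c s i p
          ∂((volume.restrict (Set.Ioi (0 : ℝ))).prod (R.trajLaw z)) :=
        (integral_tsum_of_summable_integral_norm hint hsum).symm
    _ = ∑' i, R.discountedMean s (fun x => c x) i z / s := by
        congr with i
        rw [integral_prod_symm _ (hint i)]
        simp only [setIntegral_laplaceTerm hs, integral_div, discountedMean]
    _ = (∑' i, R.discountedMean s (fun x => c x) i z) / s := tsum_div_const

theorem UniformlyDiscounting.laplace_expectedReward_eq_discountedStep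
    (hR : R.UniformlyDiscounting) (hs : 0 < s.re) (hc : Measurable c) (hC : ∀ x, |c x| ≤ C)
    (z : S) :
    FourLevel.laplace (R.expectedReward c z) s =
      R.discountedStep s
        (fun x => c x / s + FourLevel.laplace (R.expectedReward c (R.endState x)) s) z := by
  simp only [hR.laplace_expectedReward hs hc hC]
  rw [hR.tsum_discountedMean hs (by fun_prop) (by simpa using hC) z]
  simp only [discountedStep, ← add_div, ← integral_div, mul_div_assoc]

end Reward

end MarkovRenewal

namespace FourLevel

variable {M : CallCentre} {n : Reservation}

section Events

lemma coe_totalRate (M : CallCentre) (n : Reservation) (z : State) :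
    (totalRate M n z : ℂ) = ∑ e, (rate M n z e : ℂ) := by
  rw [totalRate]
  push_cast
  rfl

lemma sum_event {A : Type*} [AddCommMonoid A] (f : Event → A) :
    ∑ e, f e = f .arrive1 + f .arrive2 + f .arrive3 + f .arrive4
      + f .serve1 + f .serve2 + f .serve3 + f .serve4
      + f .serveUp1 + f .serveUp2 + f .serveUp3
      + f .abandon1 + f .abandon2 + f .abandon3 + f .abandon4 := by
  have univ_eq : (Finset.univ : Finset Event) = {.arrive1, .arrive2, .arrive3, .arrive4, .serve1,
    .serve2, .serve3, .serve4, .serveUp1, .serveUp2, .serveUp3, .abandon1, .abandon2, .abandon3,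
    .abandon4} := rfl
  rw [univ_eq]
  simp [add_assoc]

lemma next_eq_self_iff {z : State} {e : Event} :
    next M n z e = z ↔
      M.cap ≤ z.total ∧ (e = .arrive1 ∨ e = .arrive2 ∨ e = .arrive3 ∨ e = .arrive4) := by
  cases e <;> simp only [next, State.ext_iff, reduceCtorEq, or_false, or_true, and_true] <;>
    grind

end Events

section StepLaw

variable {s : ℂ}

lemma integral_discount_sojournLaw (hs : 0 < s.re) (z : State) :
    ∫ τ, discount s τ ∂(sojournLaw M n z) = totalRate M n z / (totalRate M n z + s) := by
  unfold sojournLaw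
  split_ifs with h
  · simp [h]
  · have totalRate_pos : (0 : ℝ) < totalRate M n z := by exact_mod_cast pos_iff_ne_zero.mpr h
    rw [integral_map ENNReal.measurable_ofReal.aemeasurable
      (measurable_discount s).aestronglyMeasurable,
      integral_discount_expMeasure totalRate_pos (by linarith)]

lemma eventLaw_apply {z : State} (h : totalRate M n z ≠ 0) (e : Event) :
    (eventLaw M n z e).toReal = rate M n z e / totalRate M n z := by
  unfold eventLaw
  rw [dif_neg h, PMF.normalize_apply, tsum_rate, ENNReal.toReal_mul, ENNReal.toReal_inv,
    ENNReal.coe_toReal, ENNReal.coe_toReal, div_eq_mul_inv]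

lemma integral_discount_mul_stepLaw (hs : 0 < s.re) (w : Event × State → ℂ) (z : State) :
    ∫ x, discount s x.1 * w x.2 ∂(stepLaw M n z) =
      ∑ e, (rate M n z e : ℂ) / (totalRate M n z + s) * w (e, z) := by
  unfold stepLaw
  rw [integral_prod_mul, integral_discount_sojournLaw hs, Measure.prod_dirac,
    integral_map measurable_prodMk_right.aemeasurable
      (measurable_of_countable w).aestronglyMeasurable, PMF.integral_eq_sum, Finset.mul_sum]
  refine Finset.sum_congr rfl fun e _ => ?_
  by_cases h : totalRate M n z = 0
  · have rate_eq_zero : rate M n z e = 0 := Finset.sum_eq_zero_iff.mp h e (Finset.mem_univ e)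
    simp [h, rate_eq_zero]
  · have totalRate_ne_zero : (totalRate M n z : ℂ) ≠ 0 := by exact_mod_cast h
    rw [eventLaw_apply h, Complex.real_smul]
    push_cast
    field_simp

lemma integral_norm_discount_stepLaw (hs : 0 < s.re) (z : State) :
    ∫ x, ‖discount s x.1‖ ∂(stepLaw M n z) = totalRate M n z / (totalRate M n z + s.re) := by
  have h := integral_discount_sojournLaw (M := M) (n := n) (s := s.re) (by simpa using hs) z
  simp only [discount_re, integral_complex_ofReal] at h
  rw [stepLaw, integral_fun_fst fun τ => ‖discount s τ‖, probReal_univ, one_smul]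
  exact_mod_cast h

end StepLaw

section Finiteness

lemma served_bounds {z : State} (hz : z ∈ stateSpace M n) :
    (0 ≤ z.a1 ∧ z.a1 ≤ z.a ∧ z.a1 ≤ M.k2 - n.n2) ∧
    (0 ≤ z.b1 ∧ z.b1 ≤ z.b ∧ z.b1 ≤ M.k3 - n.n3) ∧
    (0 ≤ z.c1 ∧ z.c1 ≤ z.c ∧ z.c1 ≤ M.k4 - n.n4) := by
  obtain ⟨-, -, -, -, -, ha1, hb1, hc1⟩ := hz
  have min_mul_ind_nonneg (p q : ℤ) (P : Prop) [Decidable P] (h : P → 0 ≤ p ∧ 0 ≤ q) :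
      0 ≤ min p q * ind P := by
    unfold ind
    split_ifs with hP
    · simpa using h hP
    · simp
  have a1_nonneg := (min_mul_ind_nonneg _ _ _ (by omega)).trans ha1.1
  have b1_nonneg := (min_mul_ind_nonneg _ _ _ (by omega)).trans hb1.1
  have c1_nonneg := (min_mul_ind_nonneg _ _ _ (by omega)).trans hc1.1
  omega

lemma finite_stateSpace (M : CallCentre) (n : Reservation) : (stateSpace M n).Finite := by
  refine ((Set.finite_Icc (0 : ℤ × ℤ × ℤ × ℤ × ℤ × ℤ × ℤ)
    (M.cap, M.cap, M.cap, M.cap, M.cap, M.cap, M.cap)).image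
      fun p => (⟨p.1, p.2.1, p.2.2.1, p.2.2.2.1, p.2.2.2.2.1, p.2.2.2.2.2.1, p.2.2.2.2.2.2⟩ :
        State)).subset fun z hz => ?_
  refine ⟨(z.a, z.a1, z.b, z.b1, z.c, z.c1, z.d), ?_, rfl⟩
  have bounds := served_bounds hz
  obtain ⟨ha, hb, hc, hd, -⟩ := hz
  simp only [Set.mem_Icc, Prod.le_def, Prod.fst_zero, Prod.snd_zero]
  omega

lemma exists_totalRate_le (M : CallCentre) (n : Reservation) :
    ∃ B : ℝ≥0, ∀ z, totalRate M n z ≤ B := by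
  obtain ⟨B, hB⟩ := ((finite_stateSpace M n).image (totalRate M n)).bddAbove
  refine ⟨B, fun z => ?_⟩
  by_cases hz : z ∈ stateSpace M n
  · exact hB ⟨z, hz, rfl⟩
  · simp [totalRate, rate, hz]

lemma exists_abs_cost_le (M : CallCentre) : ∃ C : ℝ, ∀ z e, |cost M z e| ≤ C := by
  refine ⟨|M.beta| + |M.gamma1| + |M.gamma2| + |M.gamma3| + |M.gamma4|, fun z e => ?_⟩
  cases e <;> simp only [cost] <;> grind

end Finiteness

section Renewal

variable {s : ℂ}

/-- The call centre as a Markov renewal process: a step is the wait for an event, and leads to the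
state after that event. By unfolding, `chainLaw`, `costTerm` and `expectedCost` are its `trajLaw`,
`rewardTerm` and `expectedReward` for the reward `stepCost`. -/
def renewal (M : CallCentre) (n : Reservation) : MarkovRenewal State Step where
  stepLaw := Kernel.ofFunOfCountable (stepLaw M n)
  isMarkovKernel_stepLaw := ⟨fun z => inferInstanceAs (IsProbabilityMeasure (stepLaw M n z))⟩
  endState := stateAfter M n
  measurable_endState := measurable_stateAfter M n
  duration := Prod.fst
  measurable_duration := measurable_fst

/-- The cost of the event that ends a step. -/
def stepCost (M : CallCentre) (x : Step) : ℝ := cost M x.2.2 x.2.1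

lemma measurable_stepCost (M : CallCentre) : Measurable (stepCost M) :=
  (measurable_of_countable fun y : Event × State => cost M y.2 y.1).comp measurable_snd

lemma uniformlyDiscounting_renewal (M : CallCentre) (n : Reservation) :
    (renewal M n).UniformlyDiscounting := by
  intro s hs
  obtain ⟨B, hB⟩ := exists_totalRate_le M n
  refine ⟨B / (B + s.re), (div_lt_one (by positivity)).mpr (by linarith), fun z => ?_⟩
  have hBz : (totalRate M n z : ℝ) ≤ B := by exact_mod_cast hB z
  calc ∫ x, ‖discount s x.1‖ ∂(stepLaw M n z)
      = totalRate M n z / (totalRate M n z + s.re) := integral_norm_discount_stepLaw hs z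
    _ ≤ B / (B + s.re) := by
        rw [div_le_div_iff₀ (by positivity) (by positivity)]
        nlinarith

lemma ae_summable_costTerm (M : CallCentre) (n : Reservation) (z : State) (t : ℝ) :
    ∀ᵐ ω ∂(chainLaw M n z), Summable (costTerm M t ω) :=
  have ⟨_, hC⟩ := exists_abs_cost_le M
  (uniformlyDiscounting_renewal M n).ae_summable_rewardTerm (measurable_stepCost M)
    (fun x => hC x.2.2 x.2.1) z t

lemma integrable_totalCost (M : CallCentre) (n : Reservation) (z : State) (t : ℝ) :
    Integrable (totalCost M t) (chainLaw M n z) :=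
  have ⟨_, hC⟩ := exists_abs_cost_le M
  (uniformlyDiscounting_renewal M n).integrable_tsum_rewardTerm (measurable_stepCost M)
    (fun x => hC x.2.2 x.2.1) z t

lemma integrableOn_exp_mul_expectedCost (hs : 0 < s.re) (z : State) :
    IntegrableOn (fun t : ℝ => Complex.exp (-s * t) * (expectedCost M n z t : ℂ)) (Set.Ioi 0) :=
  have ⟨_, hC⟩ := exists_abs_cost_le M
  (uniformlyDiscounting_renewal M n).integrableOn_exp_mul_expectedReward hs
    (measurable_stepCost M) (fun x => hC x.2.2 x.2.1) z

lemma totalRate_add_ne_zero (hs : 0 < s.re) (z : State) : (totalRate M n z : ℂ) + s ≠ 0 := by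
  apply Complex.ne_zero_of_re_pos
  exact add_pos_of_nonneg_of_pos (totalRate M n z).2 hs

lemma totalRate_add_mul_laplaceCost (hs : 0 < s.re) (z : State) :
    (totalRate M n z + s) * laplaceCost M n s z =
      ∑ e, (rate M n z e : ℂ) * (laplaceCost M n s (next M n z e) + cost M z e / s) := by
  obtain ⟨_, hC⟩ := exists_abs_cost_le M
  have hne := totalRate_add_ne_zero (M := M) (n := n) hs z
  calc (totalRate M n z + s) * laplaceCost M n s z
      = (totalRate M n z + s) * ∫ x, discount s x.1 *
          (cost M x.2.2 x.2.1 / s + laplaceCost M n s (next M n x.2.2 x.2.1))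
          ∂(stepLaw M n z) := congrArg _ <|
        (uniformlyDiscounting_renewal M n).laplace_expectedReward_eq_discountedStep hs
          (measurable_stepCost M) (fun x => hC _ _) z
    _ = _ := by
        rw [integral_discount_mul_stepLaw hs
          (fun y => cost M y.2 y.1 / s + laplaceCost M n s (next M n y.2 y.1)), Finset.mul_sum]
        refine Finset.sum_congr rfl fun e _ => ?_
        rw [← mul_assoc, mul_div_cancel₀ _ hne, add_comm]

lemma laplaceCost_of_notMem (hs : 0 < s.re) {z : State} (hz : z ∉ stateSpace M n) :
    laplaceCost M n s z = 0 := by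
  have hs₀ : s ≠ 0 := Complex.ne_zero_of_re_pos hs
  simpa [totalRate, rate, hz, hs₀] using totalRate_add_mul_laplaceCost (M := M) (n := n) hs z

end Renewal

section BackwardEquation

variable {s : ℂ}

lemma natCast_toNat {R : Type*} [AddGroupWithOne R] {m : ℤ} (hm : 0 ≤ m) :
    (m.toNat : R) = m := by
  exact_mod_cast congrArg (Int.cast (R := R)) (Int.toNat_of_nonneg hm)

open Classical in
lemma psi_eq_sum_rate_add {z : State} (hz : z ∈ stateSpace M n) (s : ℂ) :
    psi M s z = (∑ e with next M n z e ≠ z, (rate M n z e : ℂ)) + s := by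
  have bounds := served_bounds hz
  rw [Finset.sum_filter, sum_event]
  simp only [ne_eq, next_eq_self_iff, rate, if_pos hz]
  obtain ⟨ha, hb, hc, hd, htotal, -⟩ := hz
  obtain ⟨a, a1, b, b1, c, c1, d⟩ := z
  simp only [State.total] at *
  push_cast
  simp (disch := omega) only [natCast_toNat]
  rcases htotal.lt_or_eq with h | h
  · simp only [psi, ind, h, ↓reduceIte, Int.cast_one, mul_one, or_self, or_false, and_true,
      not_le, or_true, and_false, not_false_eq_true, add_left_inj]
    ring
  · simp only [psi, ind, h, lt_self_iff_false, ↓reduceIte, Int.cast_zero, mul_zero, zero_add,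
      Std.le_refl, or_self, or_false, and_self, not_true_eq_false, or_true, add_zero, and_false,
      not_false_eq_true, add_left_inj]
    ring

open Classical in
lemma xi_eq_sum_rate_mul {z : State} (hz : z ∈ stateSpace M n) (s : ℂ) (A : State → ℂ) :
    xi M n s A z = (∑ e with next M n z e ≠ z, (rate M n z e : ℂ) * A (next M n z e)) +
      ∑ e, (rate M n z e : ℂ) * (cost M z e / s) := by
  have bounds := served_bounds hz
  rw [Finset.sum_filter, sum_event, sum_event]
  simp only [ne_eq, next_eq_self_iff, rate, if_pos hz]
  obtain ⟨ha, hb, hc, hd, htotal, -⟩ := hz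
  obtain ⟨a, a1, b, b1, c, c1, d⟩ := z
  simp only [State.total] at *
  push_cast
  simp (disch := omega) only [natCast_toNat]
  rcases htotal.lt_or_eq with h | h
  · simp only [xi, ind, ge_iff_le, h, ↓reduceIte, Int.cast_one, mul_one, gt_iff_lt, h.ne,
      Int.cast_zero, mul_zero, zero_div, add_zero, or_self, or_false, and_true, not_le, next,
      State.total, or_true, and_false, not_false_eq_true, cost, Complex.ofReal_zero, zero_add]
    ring
  · simp only [xi, ind, ge_iff_le, h, lt_self_iff_false, ↓reduceIte, Int.cast_zero, mul_zero,
      zero_add, gt_iff_lt, Int.cast_one, mul_one, Std.le_refl, or_self, or_false, and_self,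
      not_true_eq_false, or_true, add_zero, and_false, not_false_eq_true, next, cost, State.total,
      Complex.ofReal_zero, zero_div]
    ring

lemma psi_ne_zero (hs : 0 < s.re) {z : State} (hz : z ∈ stateSpace M n) : psi M s z ≠ 0 := by
  classical
  apply Complex.ne_zero_of_re_pos
  rw [psi_eq_sum_rate_add hz, Complex.add_re, Complex.re_sum]
  exact add_pos_of_nonneg_of_pos (Finset.sum_nonneg fun e _ => (rate M n z e).2) hs

lemma psi_mul_laplaceCost (hs : 0 < s.re) {z : State} (hz : z ∈ stateSpace M n) :
    psi M s z * laplaceCost M n s z = xi M n s (laplaceCost M n s) z := by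
  classical
  have first_event := totalRate_add_mul_laplaceCost (M := M) (n := n) hs z
  have self_loops : ∑ e with ¬ next M n z e ≠ z,
        (rate M n z e : ℂ) * laplaceCost M n s (next M n z e) =
      (∑ e with ¬ next M n z e ≠ z, (rate M n z e : ℂ)) * laplaceCost M n s z := by
    rw [Finset.sum_mul]
    refine Finset.sum_congr rfl fun e he => ?_
    rw [not_not.mp (Finset.mem_filter.mp he).2]
  simp only [mul_add, Finset.sum_add_distrib] at first_event
  rw [coe_totalRate, ← Finset.sum_filter_add_sum_filter_not _ (fun e => next M n z e ≠ z),
    ← Finset.sum_filter_add_sum_filter_not (f := fun e => (rate M n z e : ℂ) * _) _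
      (fun e => next M n z e ≠ z), self_loops] at first_event
  rw [psi_eq_sum_rate_add hz, xi_eq_sum_rate_mul hz]
  linear_combination first_event

end BackwardEquation

end FourLevel

end

theorem mainTheorem2 (M : FourLevel.CallCentre) (n : FourLevel.Reservation)
    (hn : n.Admissible M) :
    (∀ (z : FourLevel.State) (t : ℝ),
      (∀ᵐ ω ∂(FourLevel.chainLaw M n z), Summable (FourLevel.costTerm M t ω)) ∧
      MeasureTheory.Integrable (FourLevel.totalCost M t) (FourLevel.chainLaw M n z)) ∧
    ∀ s : ℂ, 0 < s.re →
      (∀ z : FourLevel.State, MeasureTheory.IntegrableOn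
        (fun t : ℝ => Complex.exp (-s * t) * (FourLevel.expectedCost M n z t : ℂ))
        (Set.Ioi 0)) ∧
      (∀ z ∈ FourLevel.stateSpace M n,
        FourLevel.psi M s z ≠ 0 ∧
        FourLevel.laplaceCost M n s z =
          FourLevel.xi M n s (FourLevel.laplaceCost M n s) z / FourLevel.psi M s z) ∧
      (∀ z ∉ FourLevel.stateSpace M n, FourLevel.laplaceCost M n s z = 0) := by
  refine ⟨fun z t => ⟨FourLevel.ae_summable_costTerm M n z t,
      FourLevel.integrable_totalCost M n z t⟩,
    fun s hs => ⟨fun z => FourLevel.integrableOn_exp_mul_expectedCost hs z,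
      fun z hz => ⟨FourLevel.psi_ne_zero hs hz, ?_⟩,
      fun z hz => FourLevel.laplaceCost_of_notMem hs hz⟩⟩
  rw [eq_div_iff (FourLevel.psi_ne_zero hs hz), mul_comm, FourLevel.psi_mul_laplaceCost hs hz]
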